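/- Let $K$ be a number field with algebraic closure $\overline{K}$, let $K^{\mathrm{ab}}\subseteq\overline K$ be the maximal abelian extension of $K$, let $d\ge 2$ be an integer, and let $a,c,\alpha\in K$ with $a\neq 0$. Put $f=ax^d+c$ and suppose that $0$ is periodic under $f$, i.e. $f^{n}(0)=0$ for some $n\ge 1$. Let $T_\infty(f,\alpha)=\bigcup_{n\ge 0}f^{-n}(\alpha)\subseteq\overline{K}$, let $K_\infty(f,\alpha)=K(T_\infty(f,\alpha))$ and $G_\infty(f,\alpha)=\mathrm{Gal}(K_\infty(f,\alpha)/K)$. For a field $K\subseteq L\subseteq\overline K$, call pairs $(f,\alpha)$ and $(g,\beta)$ $L$-conjugate if there is $m=ux+v$ with $u,v\in L$, $u\ne 0$, such that $g=m^{-1}\circ f\circ m$ and $\beta=m^{-1}(\alpha)$. Then $G_\infty(f,\alpha)$ is abelian if and only if $c=0$ and one of the following holds: $(f,\alpha)$ is $\overline{K}$-conjugate to $(x^d,0)$ (given $c=0$, this just means $\alpha=0$); or $(f,\alpha)$ is $K^{\mathrm{ab}}$-conjugate to $(x^d,\zeta)$ for some root of unity $\zeta\in\overline K$. In particular, if $a=1$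 and $G_\infty(f,\alpha)$ is abelian, then $c=0$ and $\alpha$ is either $0$ or a root of unity. -/

import Mathlib

open Polynomial

namespace Arboreal

noncomputable section

/-- The backward orbit `T_∞(f, α)`: all `β` in the fixed algebraic closure of `K` with
`fⁿ(β) = α` for some `n ≥ 0`. -/
def tree {K : Type*} [Field K] (f : K[X]) (α : K) : Set (AlgebraicClosure K) :=
  {β | ∃ n : ℕ, (fun x : AlgebraicClosure K => aeval x f)^[n] β
    = algebraMap K (AlgebraicClosure K) α}

/-- The arboreal field `K_∞(f, α) = K(T_∞(f, α))`. -/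
def arborealField {K : Type*} [Field K] (f : K[X]) (α : K) :
    IntermediateField K (AlgebraicClosure K) :=
  IntermediateField.adjoin K (tree f α)

/-- The dynamical Galois group `G_∞(f, α) = Gal(K_∞(f, α)/K)`. -/
abbrev dynGal {K : Type*} [Field K] (f : K[X]) (α : K) : Type _ :=
  arborealField f α ≃ₐ[K] arborealField f α

/-- The maximal abelian extension `K^ab` of `K` inside the fixed algebraic closure: the compositum
of all abelian Galois extensions of `K`. -/
def maxAbelian (K : Type*) [Field K] : IntermediateField K (AlgebraicClosure K) :=
  sSup {E | IsAbelianGalois K E}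

/-- The pairs `(f, α)` and `(g, β)` are `L`-conjugate: there is `m = u x + v` with `u, v ∈ L`,
`u ≠ 0`, such that `g = m⁻¹ ∘ f ∘ m` and `β = m⁻¹(α)`. -/
def IsConjugateOver {K : Type*} [Field K] (L : IntermediateField K (AlgebraicClosure K))
    (f : (AlgebraicClosure K)[X]) (α : AlgebraicClosure K)
    (g : (AlgebraicClosure K)[X]) (β : AlgebraicClosure K) : Prop :=
  ∃ u ∈ L, ∃ v ∈ L, u ≠ 0 ∧
    f.comp (C u * X + C v) = (C u * X + C v).comp g ∧
    (C u * X + C v).eval β = α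

end

end Arboreal

/-!
A scaling turns `a x ^ d + c` into a monic map `φ = x ^ d + c`. Suppose that the backward orbit `T`
of a point `α` under `φ` lies in `K^ab`. Since `0` is periodic and `y ^ d - s ^ d` is the product of
the `y - ζ s` over the `d`-th roots of unity `ζ`, every element of `T` is a product of elements
`ζ w ^ d` with `w ∈ T`, hence a `d ^ m`-th power in `K^ab` for every `m`. If `x = z ^ N` with
`x ∈ K`, `z ∈ K^ab` and an automorphism `τ` over `K` raises the `N`-th roots of unity to the power
`g`, then `z ^ g / τ z` lies in `K` and is an `N`-th root of `x ^ (g - 1)`. A suitable `g > 1`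
serves all `N = d ^ m`, so by Northcott's theorem, applied over `K(x)` for `x ∈ T`, each element of
`T` is zero or a root of unity. In particular `T` is bounded in `ℂ`. But if `y ∈ φ⁻¹(T)`, then
`ξ y ∈ T` for every `d`-th root of unity `ξ`, and the mean of `|ξ y - c|²` over these `ξ` is
`|y|² + |c|²`, so iterating preimages makes `T` unbounded unless `c = 0`.
-/

namespace Arboreal

section CommutingField

variable {K Ω : Type*} [Field K] [Field Ω] [Algebra K Ω]

/-- The elements of `Ω` on which any two automorphisms of `Ω / K` commute, that is, the fixed field
of the commutator subgroup of `Gal(Ω / K)`. It plays the role of `K^ab` for an algebraic closure `Ω`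
that need not be `AlgebraicClosure K`, so that `K` can be replaced by a finite extension. -/
def commutingField (K Ω : Type*) [Field K] [Field Ω] [Algebra K Ω] : IntermediateField K Ω where
  carrier := {x | ∀ ρ τ : Ω ≃ₐ[K] Ω, ρ (τ x) = τ (ρ x)}
  mul_mem' hx hy ρ τ := by simp only [map_mul, hx ρ τ, hy ρ τ]
  add_mem' hx hy ρ τ := by simp only [map_add, hx ρ τ, hy ρ τ]
  algebraMap_mem' r ρ τ := by simp only [AlgEquiv.commutes]
  inv_mem' x hx ρ τ := by simp only [map_inv₀, hx ρ τ]

theorem commutingField_le_restrictScalars (E : IntermediateField K Ω) :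
    commutingField K Ω ≤ (commutingField E Ω).restrictScalars K := fun _ hx ρ τ =>
  hx (ρ.restrictScalars K) (τ.restrictScalars K)

theorem apply_mem_commutingField {x : Ω} (hx : x ∈ commutingField K Ω) (ρ : Ω ≃ₐ[K] Ω) :
    ρ x ∈ commutingField K Ω := fun σ τ =>
  calc σ (τ (ρ x)) = (τ * ρ) (σ x) := hx σ (τ * ρ)
    _ = τ (ρ (σ x)) := rfl
    _ = τ (σ (ρ x)) := by rw [hx ρ σ]

theorem mem_commutingField_of_isOfFinOrder {ζ : Ω} (hζ : IsOfFinOrder ζ) :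
    ζ ∈ commutingField K Ω := by
  have : NeZero (orderOf ζ) := ⟨hζ.orderOf_pos.ne'⟩
  have exists_pow (ρ : Ω ≃ₐ[K] Ω) : ∃ i : ℕ, ρ ζ = ζ ^ i := by
    obtain ⟨i, -, hi⟩ := (IsPrimitiveRoot.orderOf ζ).eq_pow_of_pow_eq_one
      (ξ := ρ ζ) (by rw [← map_pow, pow_orderOf_eq_one, map_one])
    exact ⟨i, hi.symm⟩
  intro ρ τ
  obtain ⟨i, hi⟩ := exists_pow ρ
  obtain ⟨j, hj⟩ := exists_pow τ
  rw [hi, hj, map_pow, map_pow, hi, hj, pow_right_comm]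

theorem normal_of_forall_apply_mem [Normal K Ω] {E : IntermediateField K Ω}
    (h : ∀ ρ : Ω ≃ₐ[K] Ω, ∀ x ∈ E, ρ x ∈ E) : Normal K E := by
  rw [IntermediateField.normal_iff_forall_map_le']
  rintro ρ _ ⟨x, hx, rfl⟩
  exact h ρ x hx

theorem isMulCommutative_algEquiv_iff [Normal K Ω] (E : IntermediateField K Ω) [Normal K E] :
    IsMulCommutative (E ≃ₐ[K] E) ↔ E ≤ commutingField K Ω := by
  rw [isMulCommutative_iff]
  constructor
  · intro hcomm x hx ρ τ
    have h := congrArg (fun σ : E ≃ₐ[K] E => algebraMap E Ω (σ ⟨x, hx⟩))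
      (hcomm (ρ.restrictNormal E) (τ.restrictNormal E))
    simp only [AlgEquiv.mul_apply, AlgEquiv.restrictNormal_commutes] at h
    exact h
  · intro hE ρ τ
    ext x
    have hlift (σ : E ≃ₐ[K] E) (y : E) : σ.liftNormal Ω (y : Ω) = (σ y : E) :=
      σ.liftNormal_commutes Ω y
    have h := hE x.2 (ρ.liftNormal Ω) (τ.liftNormal Ω)
    simp only [hlift] at h
    exact h

theorem maxAbelian_eq_commutingField [PerfectField K] :
    maxAbelian K = commutingField K (AlgebraicClosure K) := by
  apply le_antisymm
  · exact sSup_le fun E (hE : IsAbelianGalois K E) =>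
      (isMulCommutative_algEquiv_iff E).1 inferInstance
  · have : Normal K (commutingField K (AlgebraicClosure K)) :=
      normal_of_forall_apply_mem fun ρ x hx => apply_mem_commutingField hx ρ
    have := (isMulCommutative_algEquiv_iff (commutingField K (AlgebraicClosure K))).2 le_rfl
    have : IsGalois K (commutingField K (AlgebraicClosure K)) := ⟨⟩
    exact le_sSup (show IsAbelianGalois K _ from { })

end CommutingField

section BackwardOrbit

variable {X Y : Type*} {φ : X → X} {ψ : Y → Y}

/-- The backward orbit `⋃ₙ φ⁻ⁿ(b)` of a point `b` under a self-map `φ`. -/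
def backwardOrbit (φ : X → X) (b : X) : Set X :=
  {x | ∃ n : ℕ, φ^[n] x = b}

theorem self_mem_backwardOrbit (φ : X → X) (b : X) : b ∈ backwardOrbit φ b := ⟨0, rfl⟩

theorem preimage_backwardOrbit_subset (φ : X → X) (b : X) :
    φ ⁻¹' backwardOrbit φ b ⊆ backwardOrbit φ b := fun _ ⟨n, hn⟩ => ⟨n + 1, hn⟩

theorem apply_mem_backwardOrbit_iff {m : X → Y} (hm : m.Injective)
    (h : Function.Semiconj m φ ψ) {x b : X} :
    m x ∈ backwardOrbit ψ (m b) ↔ x ∈ backwardOrbit φ b :=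
  exists_congr fun n => by rw [← h.iterate_right n x, hm.eq_iff]

theorem isOfFinOrder_of_mem_backwardOrbit_pow {M : Type*} [Monoid M] {d : ℕ} (hd : d ≠ 0)
    {ζ x : M} (hζ : IsOfFinOrder ζ) (hx : x ∈ backwardOrbit (· ^ d) ζ) : IsOfFinOrder x := by
  obtain ⟨n, hn⟩ := hx
  rw [pow_iterate] at hn
  subst hn
  exact hζ.of_pow (pow_ne_zero n hd)

theorem eq_zero_of_mem_backwardOrbit_pow {M : Type*} [MonoidWithZero M] [NoZeroDivisors M]
    {d : ℕ} {x : M} (hx : x ∈ backwardOrbit (· ^ d) 0) : x = 0 := by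
  obtain ⟨n, hn⟩ := hx
  rw [pow_iterate] at hn
  exact eq_zero_of_pow_eq_zero hn

end BackwardOrbit

section DynGal

variable {K : Type*} [Field K] {f : K[X]} {α : K}

theorem tree_eq_backwardOrbit (f : K[X]) (α : K) :
    tree f α = backwardOrbit (fun x => aeval x f) (algebraMap K (AlgebraicClosure K) α) :=
  rfl

theorem apply_mem_tree {x : AlgebraicClosure K} (hx : x ∈ tree f α)
    (ρ : AlgebraicClosure K ≃ₐ[K] AlgebraicClosure K) : ρ x ∈ tree f α := by
  have hρ : Function.Semiconj ρ (fun x => aeval x f) (fun x => aeval x f) := fun x =>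
    (aeval_algHom_apply ρ x f).symm
  have h := (apply_mem_backwardOrbit_iff ρ.injective hρ).2 hx
  rwa [ρ.commutes] at h

theorem isMulCommutative_dynGal_iff :
    IsMulCommutative (dynGal f α) ↔ tree f α ⊆ commutingField K (AlgebraicClosure K) := by
  have : Normal K (arborealField f α) := normal_of_forall_apply_mem fun ρ =>
    show arborealField f α ≤ (arborealField f α).comap ρ.toAlgHom from
      IntermediateField.adjoin_le_iff.2 fun y hy =>
        IntermediateField.subset_adjoin K _ (apply_mem_tree hy ρ)
  rw [isMulCommutative_algEquiv_iff, arborealField, IntermediateField.adjoin_le_iff]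

end DynGal

section Unicritical

/-- The monic unicritical map `x ↦ x ^ d + c`. -/
def unicritical {R : Type*} [Semiring R] (d : ℕ) (c : R) (x : R) : R :=
  x ^ d + c

variable {Ω : Type*} [Field Ω] {d : ℕ} {c : Ω} {T : Set Ω}

theorem mul_mem_of_pow_eq_one (hT : unicritical d c ⁻¹' T ⊆ T) {ζ y : Ω} (hζ : ζ ^ d = 1)
    (hy : unicritical d c y ∈ T) : ζ * y ∈ T :=
  hT (by rwa [Set.mem_preimage, unicritical, mul_pow, hζ, one_mul])

variable [IsAlgClosed Ω]

theorem exists_mem_unicritical_eq (hd : 0 < d) (hT : unicritical d c ⁻¹' T ⊆ T) {x : Ω}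
    (hx : x ∈ T) : ∃ y ∈ T, unicritical d c y = x := by
  obtain ⟨y, hy⟩ := IsAlgClosed.exists_pow_nat_eq (x - c) hd
  have hyx : unicritical d c y = x := by rw [unicritical, hy, sub_add_cancel]
  exact ⟨y, hT (by rwa [Set.mem_preimage, hyx]), hyx⟩

-- Writing `x = y ^ d + c` and `s = φⁿ(0)` for `φ = unicritical d c`, one has
-- `x - φⁿ⁺¹(0) = y ^ d - s ^ d`, which is the product of the `y - ζ s` over `ζ ^ d = 1`, and each
-- `ζ⁻¹ y` lies in `T` again.
theorem sub_iterate_unicritical_zero_mem [NeZero (d : Ω)] (hT : unicritical d c ⁻¹' T ⊆ T)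
    {P : Submonoid Ω} (hroot : ∀ ζ : Ω, ζ ^ d = 1 → ζ ∈ P) (hpow : ∀ y ∈ T, y ^ d ∈ P) (n : ℕ) :
    ∀ x ∈ T, x - (unicritical d c)^[n + 1] 0 ∈ P := by
  have hd : 0 < d := Nat.pos_of_ne_zero (NeZero.of_neZero_natCast Ω).out
  induction n with
  | zero =>
    intro x hx
    obtain ⟨y, hyT, rfl⟩ := exists_mem_unicritical_eq hd hT hx
    simpa [unicritical, hd.ne'] using hpow y hyT
  | succ n ih =>
    intro x hx
    obtain ⟨ξ, hξ⟩ := HasEnoughRootsOfUnity.exists_primitiveRoot Ω d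
    obtain ⟨y, -, rfl⟩ := exists_mem_unicritical_eq hd hT hx
    rw [Function.iterate_succ_apply']
    set s := (unicritical d c)^[n + 1] 0
    rw [unicritical, unicritical, add_sub_add_right_eq_sub, hξ.pow_sub_pow_eq_prod_sub_mul _ _ hd]
    refine P.prod_mem fun ζ hζ => ?_
    rw [mem_nthRootsFinset hd] at hζ
    have hζ0 : ζ ≠ 0 := (IsUnit.of_pow_eq_one hζ hd.ne').ne_zero
    rw [show y - ζ * s = ζ * (ζ⁻¹ * y - s) by field_simp]
    exact mul_mem (hroot ζ hζ)
      (ih _ (mul_mem_of_pow_eq_one hT (by rw [inv_pow, hζ, inv_one]) hx))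

theorem subset_of_zero_mem_periodicPts [NeZero (d : Ω)] (hT : unicritical d c ⁻¹' T ⊆ T)
    (hper : 0 ∈ Function.periodicPts (unicritical d c)) {P : Submonoid Ω}
    (hroot : ∀ ζ : Ω, ζ ^ d = 1 → ζ ∈ P) (hpow : ∀ y ∈ T, y ^ d ∈ P) : T ⊆ P := by
  obtain ⟨n, hn, h0⟩ := hper
  obtain ⟨n, rfl⟩ := Nat.exists_eq_succ_of_ne_zero hn.ne'
  intro x hx
  have h := sub_iterate_unicritical_zero_mem hT hroot hpow n x hx
  rwa [h0.eq, sub_zero] at h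

theorem subset_map_powMonoidHom [NeZero (d : Ω)] (hT : unicritical d c ⁻¹' T ⊆ T)
    (hper : 0 ∈ Function.periodicPts (unicritical d c)) {A : Submonoid Ω}
    (hA : ∀ ζ : Ω, IsOfFinOrder ζ → ζ ∈ A) (hTA : T ⊆ A) (m : ℕ) :
    T ⊆ A.map (powMonoidHom (d ^ m)) := by
  have hd : 0 < d := Nat.pos_of_ne_zero (NeZero.of_neZero_natCast Ω).out
  induction m with
  | zero => exact fun x hx => ⟨x, hTA hx, by simp⟩
  | succ m ih =>
    refine subset_of_zero_mem_periodicPts hT hper (fun ζ hζ => ?_) fun y hy => ?_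
    · obtain ⟨w, hw⟩ := IsAlgClosed.exists_pow_nat_eq ζ (pow_pos hd (m + 1))
      have hfin : IsOfFinOrder (w ^ d ^ (m + 1)) :=
        hw ▸ isOfFinOrder_iff_pow_eq_one.2 ⟨d, hd, hζ⟩
      exact ⟨w, hA w (hfin.of_pow (pow_pos hd _).ne'), hw⟩
    · obtain ⟨w, hwA, rfl⟩ := ih hy
      exact ⟨w, hwA, by simp only [powMonoidHom_apply, pow_succ, pow_mul]⟩

theorem sum_normSq_pow_mul_sub {ξ : ℂ} (hd : 1 < d) (hξ : IsPrimitiveRoot ξ d) (y c : ℂ) :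
    ∑ i ∈ Finset.range d, Complex.normSq (ξ ^ i * y - c)
      = d * (Complex.normSq y + Complex.normSq c) := by
  have hnorm : Complex.normSq ξ = 1 := by
    rw [Complex.normSq_eq_norm_sq, hξ.norm'_eq_one (by omega), one_pow]
  have hcross : ∑ i ∈ Finset.range d, (ξ ^ i * y * starRingEnd ℂ c).re = 0 := by
    rw [← Complex.re_sum, ← Finset.sum_mul, ← Finset.sum_mul, hξ.geom_sum_eq_zero hd, zero_mul,
      zero_mul, Complex.zero_re]
  simp only [Complex.normSq_sub, map_mul, map_pow, hnorm, one_pow, one_mul]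
  rw [Finset.sum_sub_distrib, ← Finset.mul_sum, hcross, mul_zero, sub_zero, Finset.sum_const,
    Finset.card_range, nsmul_eq_mul]

-- Every `y` with `φ(y) ∈ T` yields another such point `z` with `|z|² ≥ |y|² + |c|²`: choose `ξⁱ y`
-- at least as far from `c` as the average and write it as `z ^ d + c`.
theorem eq_zero_of_preimage_unicritical_subset (ι : Ω →+* ℂ) (hd : 2 ≤ d)
    (hT : unicritical d c ⁻¹' T ⊆ T) (hne : T.Nonempty) (hle : ∀ x ∈ T, ‖ι x‖ ≤ 1) : c = 0 := by
  have hd0 : d ≠ 0 := by omega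
  have : CharZero Ω := ι.charZero
  have : NeZero (d : Ω) := ⟨Nat.cast_ne_zero.2 hd0⟩
  obtain ⟨ξ, hξ⟩ := HasEnoughRootsOfUnity.exists_primitiveRoot Ω d
  have hle' (x : Ω) (hx : x ∈ T) : Complex.normSq (ι x) ≤ 1 := by
    rw [Complex.normSq_eq_norm_sq]
    exact pow_le_one₀ (norm_nonneg _) (hle x hx)
  have step (y : Ω) (hy : unicritical d c y ∈ T) : ∃ z, unicritical d c z ∈ T ∧
      Complex.normSq (ι y) + Complex.normSq (ι c) ≤ Complex.normSq (ι z) := by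
    have hsum := sum_normSq_pow_mul_sub (by omega) (hξ.map_of_injective ι.injective) (ι y) (ι c)
    obtain ⟨i, -, hi⟩ := Finset.exists_le_of_sum_le
      (f := fun _ => Complex.normSq (ι y) + Complex.normSq (ι c))
      (Finset.nonempty_range_iff.2 hd0)
      (by rw [hsum, Finset.sum_const, Finset.card_range, nsmul_eq_mul])
    have hiT : ξ ^ i * y ∈ T :=
      mul_mem_of_pow_eq_one hT (by rw [pow_right_comm, hξ.pow_eq_one, one_pow]) hy
    obtain ⟨z, hz, hzy⟩ := exists_mem_unicritical_eq hd0.bot_lt hT hiT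
    refine ⟨z, hzy ▸ hiT, hi.trans ?_⟩
    rw [← map_pow, ← map_mul, ← map_sub, ← hzy, unicritical, add_sub_cancel_right, map_pow, map_pow]
    exact pow_le_of_le_one (Complex.normSq_nonneg _) (hle' z hz) hd0
  have grow (n : ℕ) : ∃ y, unicritical d c y ∈ T ∧
      n * Complex.normSq (ι c) ≤ Complex.normSq (ι y) := by
    induction n with
    | zero =>
      obtain ⟨x, hx⟩ := hne
      obtain ⟨y, -, rfl⟩ := exists_mem_unicritical_eq hd0.bot_lt hT hx
      exact ⟨y, hx, by simpa using Complex.normSq_nonneg _⟩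
    | succ n ih =>
      obtain ⟨y, hy, hny⟩ := ih
      obtain ⟨z, hz, hyz⟩ := step y hy
      exact ⟨z, hz, by push_cast; linarith⟩
  by_contra hc
  have hcpos : 0 < Complex.normSq (ι c) := Complex.normSq_pos.2 ((map_ne_zero ι).2 hc)
  obtain ⟨n, hn⟩ := exists_lt_nsmul hcpos 1
  obtain ⟨y, hy, hny⟩ := grow n
  rw [nsmul_eq_mul] at hn
  exact absurd (hn.trans_le hny) (hle' y (hT hy)).not_gt

end Unicritical

section InfinitelyDivisible

theorem isOfFinOrder_of_forall_exists_pow_eq {K : Type*} [Field K] [Height.AdmissibleAbsValues K]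
    [Northcott (Height.mulHeight₁ (K := K))] {d : ℕ} (hd : 2 ≤ d) {x : K} (hx : x ≠ 0)
    (h : ∀ m : ℕ, ∃ y : K, y ^ d ^ m = x) : IsOfFinOrder x := by
  choose y hy using h
  have hbound (m : ℕ) : Height.mulHeight₁ (y m) ≤ Height.mulHeight₁ x := by
    rw [← hy m, Height.mulHeight₁_pow]
    exact le_self_pow₀ (Height.one_le_mulHeight₁ _) (pow_ne_zero m (by omega))
  obtain ⟨i, j, hij, heq⟩ := (Northcott.finite_le (h := Height.mulHeight₁ (K := K))
    (Height.mulHeight₁ x)).exists_lt_map_eq_of_forall_mem hbound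
  obtain ⟨k, rfl⟩ := Nat.exists_eq_add_of_lt hij
  have hpow : x ^ d ^ (k + 1) = x :=
    calc x ^ d ^ (k + 1) = y i ^ d ^ (i + k + 1) := by
          rw [← hy i, ← pow_mul, ← pow_add, add_assoc]
      _ = x := by rw [heq, hy]
  have h2 : 2 ≤ d ^ (k + 1) := hd.trans (Nat.le_self_pow k.succ_ne_zero d)
  refine isOfFinOrder_iff_pow_eq_one.2 ⟨d ^ (k + 1) - 1, by omega, mul_right_cancel₀ hx ?_⟩
  rw [← pow_succ, Nat.sub_add_cancel (by omega), hpow, one_mul]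

theorem exists_algEquiv_eq_pow (F K Ω : Type*) [Field F] [Field K] [Field Ω] [Algebra F K]
    [Algebra F Ω] [Algebra K Ω] [IsScalarTower F K Ω] [FiniteDimensional F K] [IsGalois F Ω] :
    ∃ D : ℕ, 0 < D ∧ ∀ σ : Ω ≃ₐ[F] Ω, ∃ τ : Ω ≃ₐ[K] Ω, ∀ x, τ x = (σ ^ D) x := by
  let L : IntermediateField F Ω := (IsScalarTower.toAlgHom F K Ω).fieldRange
  have hindex : L.fixingSubgroup.index ≠ 0 := by
    have : FiniteDimensional F L :=
      inferInstanceAs (FiniteDimensional F (IsScalarTower.toAlgHom F K Ω).toLinearMap.range)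
    rw [← IntermediateField.finrank_eq_fixingSubgroup_index]
    exact Module.finrank_pos.ne'
  refine ⟨L.fixingSubgroup.index.factorial, Nat.factorial_pos _, fun σ => ?_⟩
  have hfix := Subgroup.pow_mem_of_index_ne_zero_of_dvd hindex σ
    fun m hm hle => Nat.dvd_factorial hm hle
  exact ⟨AlgEquiv.ofRingEquiv (f := (σ ^ L.fixingSubgroup.index.factorial).toRingEquiv)
    fun k => hfix ⟨algebraMap K Ω k, k, rfl⟩, fun x => rfl⟩

theorem exists_algEquiv_rat_apply_eq_pow {Ω : Type*} [Field Ω] [CharZero Ω] [IsAlgClosure ℚ Ω]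
    {N g : ℕ} (hN : 0 < N) (hg : g.Coprime N) :
    ∃ σ : Ω ≃ₐ[ℚ] Ω, ∀ ζ : Ω, ζ ^ N = 1 → σ ζ = ζ ^ g := by
  have : IsAlgClosed Ω := IsAlgClosure.isAlgClosed ℚ
  have : Normal ℚ Ω := IsAlgClosure.normal ℚ Ω
  have : NeZero N := ⟨hN.ne'⟩
  have : NeZero (N : Ω) := ⟨Nat.cast_ne_zero.2 hN.ne'⟩
  obtain ⟨ξ, hξ⟩ := HasEnoughRootsOfUnity.exists_primitiveRoot Ω N
  have hconj : IsConjRoot ℚ (ξ ^ g) ξ := by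
    have hint := hξ.isIntegral hN
    rw [IsConjRoot, minpoly.isIntegrallyClosed_eq_field_fractions' ℚ (hint.pow g),
      minpoly.isIntegrallyClosed_eq_field_fractions' ℚ hint, hξ.minpoly_eq_pow_coprime hg]
  obtain ⟨σ, hσ⟩ := isConjRoot_iff_exists_algEquiv.1 hconj
  refine ⟨σ, fun ζ hζ => ?_⟩
  obtain ⟨i, -, rfl⟩ := hξ.eq_pow_of_pow_eq_one hζ
  rw [map_pow, hσ, pow_right_comm]

theorem pow_apply_eq_pow_pow {F Ω : Type*} [CommSemiring F] [CommSemiring Ω] [Algebra F Ω]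
    {N g : ℕ} {σ : Ω ≃ₐ[F] Ω} (hσ : ∀ ζ : Ω, ζ ^ N = 1 → σ ζ = ζ ^ g) (n : ℕ) {ζ : Ω}
    (hζ : ζ ^ N = 1) : (σ ^ n) ζ = ζ ^ g ^ n := by
  induction n with
  | zero => simp
  | succ n ih => rw [pow_succ, AlgEquiv.mul_apply, hσ ζ hζ, map_pow, ih, ← pow_mul, pow_succ]

theorem exists_algEquiv_apply_eq_pow (K Ω : Type*) [Field K] [NumberField K] [Field Ω]
    [Algebra K Ω] [IsAlgClosure K Ω] : ∃ D : ℕ, 0 < D ∧ ∀ N g : ℕ, 0 < N → g.Coprime N →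
      ∃ τ : Ω ≃ₐ[K] Ω, ∀ ζ : Ω, ζ ^ N = 1 → τ ζ = ζ ^ g ^ D := by
  have : CharZero Ω := charZero_of_injective_algebraMap (algebraMap K Ω).injective
  have : IsAlgClosure ℚ Ω := ⟨IsAlgClosure.isAlgClosed K, Algebra.IsAlgebraic.trans ℚ K Ω⟩
  have : IsGalois ℚ Ω := IsAlgClosure.isGalois ℚ Ω
  obtain ⟨D, hD, hτ⟩ := exists_algEquiv_eq_pow ℚ K Ω
  refine ⟨D, hD, fun N g hN hg => ?_⟩
  obtain ⟨σ, hσ⟩ := exists_algEquiv_rat_apply_eq_pow (Ω := Ω) hN hg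
  obtain ⟨τ, hτσ⟩ := hτ σ
  exact ⟨τ, fun ζ hζ => by rw [hτσ, pow_apply_eq_pow_pow hσ D hζ]⟩

-- The witness is `z ^ g / τ z`: any automorphism multiplies both `z ^ g` and `τ z` by the same
-- power of a root of unity, so it lies in `K`.
theorem exists_pow_eq_pow_sub_one {K Ω : Type*} [Field K] [Field Ω] [Algebra K Ω] [IsGalois K Ω]
    {N g : ℕ} (hN : 0 < N) (hg : 0 < g) {τ : Ω ≃ₐ[K] Ω} (hτ : ∀ ζ : Ω, ζ ^ N = 1 → τ ζ = ζ ^ g)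
    {x : K} (hx : x ≠ 0) {z : Ω} (hzc : z ∈ commutingField K Ω) (hz : z ^ N = algebraMap K Ω x) :
    ∃ y : K, y ^ N = x ^ (g - 1) := by
  have hx0 : algebraMap K Ω x ≠ 0 := by simpa using hx
  have hz0 : z ≠ 0 := fun h => hx0 (by rw [← hz, h, zero_pow hN.ne'])
  have hfixed (σ : Ω ≃ₐ[K] Ω) : σ (z ^ g / τ z) = z ^ g / τ z := by
    obtain ⟨ζ, hσz⟩ : ∃ ζ, σ z = ζ * z := ⟨σ z / z, (div_mul_cancel₀ _ hz0).symm⟩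
    have hζ : ζ ^ N = 1 := mul_right_cancel₀ hx0 <| by
      rw [← hz, ← mul_pow, ← hσz, ← map_pow, hz, AlgEquiv.commutes, one_mul]
    have hζ0 : ζ ≠ 0 := (IsUnit.of_pow_eq_one hζ hN.ne').ne_zero
    rw [map_div₀, map_pow, hzc σ τ, hσz, map_mul τ, hτ ζ hζ, mul_pow,
      mul_div_mul_left _ _ (pow_ne_zero g hζ0)]
  obtain ⟨y, hy⟩ := (InfiniteGalois.mem_range_algebraMap_iff_fixed (k := K) _).2 hfixed
  refine ⟨y, (algebraMap K Ω).injective ?_⟩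
  rw [map_pow, hy, div_pow, ← map_pow τ, hz, AlgEquiv.commutes, pow_right_comm, hz, map_pow,
    div_eq_iff hx0, pow_sub_one_mul hg.ne']

theorem isOfFinOrder_of_forall_exists_root {K Ω : Type*} [Field K] [NumberField K] [Field Ω]
    [Algebra K Ω] [IsAlgClosure K Ω] {d : ℕ} (hd : 2 ≤ d) {x : K} (hx : x ≠ 0)
    (h : ∀ m : ℕ, ∃ z ∈ commutingField K Ω, z ^ d ^ m = algebraMap K Ω x) : IsOfFinOrder x := by
  have : IsGalois K Ω := IsAlgClosure.isGalois K Ω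
  obtain ⟨D, hD, hτ⟩ := exists_algEquiv_apply_eq_pow K Ω
  have hg : 2 ≤ (d + 1) ^ D := le_trans (by omega) (Nat.le_self_pow hD.ne' (d + 1))
  refine .of_pow (n := (d + 1) ^ D - 1) ?_ (by omega)
  refine isOfFinOrder_of_forall_exists_pow_eq hd (pow_ne_zero _ hx) fun m => ?_
  obtain ⟨z, hzc, hz⟩ := h m
  have hN : 0 < d ^ m := pow_pos (by omega) m
  obtain ⟨τ, hτm⟩ := hτ (d ^ m) (d + 1) hN (Nat.Coprime.pow_right m (by simp))
  exact exists_pow_eq_pow_sub_one hN (by omega) hτm hx hzc hz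

theorem isAlgClosure_intermediateField {K Ω : Type*} [Field K] [Field Ω] [Algebra K Ω]
    [IsAlgClosure K Ω] (E : IntermediateField K Ω) : IsAlgClosure E Ω :=
  ⟨IsAlgClosure.isAlgClosed K, Algebra.IsAlgebraic.tower_top (K := K) E⟩

theorem numberField_adjoin_simple {K Ω : Type*} [Field K] [NumberField K] [Field Ω] [Algebra K Ω]
    [Algebra.IsAlgebraic K Ω] (x : Ω) : NumberField (IntermediateField.adjoin K {x}) :=
  have := IntermediateField.adjoin.finiteDimensional (Algebra.IsIntegral.isIntegral (R := K) x)
  NumberField.of_module_finite K _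

end InfinitelyDivisible

section Rigidity

variable {K Ω : Type*} [Field K] [NumberField K] [Field Ω] [Algebra K Ω] [IsAlgClosure K Ω]
  {d : ℕ}

theorem isOfFinOrder_of_forall_mem_map_powMonoidHom (hd : 2 ≤ d) {x : Ω} (hx : x ≠ 0)
    (h : ∀ m : ℕ, x ∈ (commutingField K Ω).toSubmonoid.map (powMonoidHom (d ^ m))) :
    IsOfFinOrder x := by
  let E := IntermediateField.adjoin K {x}
  have : NumberField E := numberField_adjoin_simple x
  have : IsAlgClosure E Ω := isAlgClosure_intermediateField E
  let x' : E := ⟨x, IntermediateField.mem_adjoin_simple_self K x⟩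
  have hx' : IsOfFinOrder x' := by
    refine isOfFinOrder_of_forall_exists_root (Ω := Ω) hd (fun h0 => hx ?_) fun m => ?_
    · exact congrArg Subtype.val h0
    · obtain ⟨z, hz, hzx⟩ := h m
      exact ⟨z, commutingField_le_restrictScalars E hz, hzx⟩
  exact (algebraMap E Ω).toMonoidHom.isOfFinOrder hx'

theorem eq_zero_or_isOfFinOrder_of_subset_commutingField (hd : 2 ≤ d) {c : Ω} {T : Set Ω}
    (hT : unicritical d c ⁻¹' T ⊆ T) (hper : 0 ∈ Function.periodicPts (unicritical d c))
    (hTK : T ⊆ commutingField K Ω) {x : Ω} (hx : x ∈ T) : x = 0 ∨ IsOfFinOrder x := by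
  have : IsAlgClosed Ω := IsAlgClosure.isAlgClosed K
  have : CharZero Ω := charZero_of_injective_algebraMap (algebraMap K Ω).injective
  have : NeZero (d : Ω) := ⟨Nat.cast_ne_zero.2 (by omega)⟩
  refine or_iff_not_imp_left.2 fun hx0 =>
    isOfFinOrder_of_forall_mem_map_powMonoidHom (K := K) hd hx0 fun m => ?_
  exact subset_map_powMonoidHom hT hper (fun ζ hζ => mem_commutingField_of_isOfFinOrder hζ) hTK m hx

theorem eq_zero_of_subset_commutingField (hd : 2 ≤ d) {c : Ω} {T : Set Ω} (hne : T.Nonempty)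
    (hT : unicritical d c ⁻¹' T ⊆ T) (hper : 0 ∈ Function.periodicPts (unicritical d c))
    (hTK : T ⊆ commutingField K Ω) : c = 0 := by
  have : IsAlgClosed Ω := IsAlgClosure.isAlgClosed K
  have : CharZero Ω := charZero_of_injective_algebraMap (algebraMap K Ω).injective
  have : Algebra.IsAlgebraic ℚ Ω := Algebra.IsAlgebraic.trans ℚ K Ω
  let ι : Ω →ₐ[ℚ] ℂ := IsAlgClosed.lift
  refine eq_zero_of_preimage_unicritical_subset (ι : Ω →+* ℂ) hd hT hne fun x hx => ?_
  rcases eq_zero_or_isOfFinOrder_of_subset_commutingField hd hT hper hTK hx with rfl | h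
  · simp
  · exact ((ι : Ω →+* ℂ).toMonoidHom.isOfFinOrder h).norm_eq_one.le

end Rigidity

section Conjugation

variable {K : Type*} [Field K] {d : ℕ} {a c α : K} {l : AlgebraicClosure K}

theorem exists_mul_eq_pow {Ω : Type*} [Field Ω] [IsAlgClosed Ω] (hd : 2 ≤ d) {a : Ω} (ha : a ≠ 0) :
    ∃ l : Ω, l ≠ 0 ∧ l * a = l ^ d := by
  obtain ⟨l, rfl⟩ := IsAlgClosed.exists_pow_nat_eq a (show 0 < d - 1 by omega)
  exact ⟨l, (pow_ne_zero_iff (by omega)).1 ha, mul_pow_sub_one (by omega) l⟩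

theorem semiconj_unicritical (hl : l * algebraMap K _ a = l ^ d) :
    Function.Semiconj (l * ·) (fun x => aeval x (C a * X ^ d + C c : K[X]))
      (unicritical d (l * algebraMap K _ c)) := fun x => by
  simp only [unicritical, map_add, map_mul, map_pow, aeval_C, aeval_X, mul_pow, ← hl]
  ring

theorem zero_mem_periodicPts_unicritical (hl : l * algebraMap K _ a = l ^ d)
    (hper : 0 ∈ Function.periodicPts fun x : K => (C a * X ^ d + C c : K[X]).eval x) :
    0 ∈ Function.periodicPts (unicritical d (l * algebraMap K _ c)) := by
  have hmap : Function.Semiconj (algebraMap K (AlgebraicClosure K))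
      (fun x => (C a * X ^ d + C c : K[X]).eval x) (fun x => aeval x (C a * X ^ d + C c : K[X])) :=
    fun x => (aeval_algebraMap_apply_eq_algebraMap_eval x _).symm
  simpa using ((semiconj_unicritical hl).comp_left hmap).mapsTo_periodicPts hper

theorem eq_zero_and_isOfFinOrder_of_isMulCommutative [NumberField K] (hd : 2 ≤ d) (hl0 : l ≠ 0)
    (hl : l * algebraMap K _ a = l ^ d)
    (hper : 0 ∈ Function.periodicPts fun x : K => (C a * X ^ d + C c : K[X]).eval x)
    (hcomm : IsMulCommutative (dynGal (C a * X ^ d + C c) α)) :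
    c = 0 ∧ (l * algebraMap K _ α = 0 ∨ IsOfFinOrder (l * algebraMap K _ α)) := by
  set f : K[X] := C a * X ^ d + C c
  set T := backwardOrbit (unicritical d (l * algebraMap K _ c)) (l * algebraMap K _ α)
  let E := IntermediateField.adjoin K {l}
  have : NumberField E := numberField_adjoin_simple l
  have : IsAlgClosure E (AlgebraicClosure K) := isAlgClosure_intermediateField E
  have hTE : T ⊆ commutingField E (AlgebraicClosure K) := fun y hy => by
    obtain ⟨x, rfl⟩ : ∃ x, l * x = y := ⟨l⁻¹ * y, mul_inv_cancel_left₀ hl0 y⟩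
    have hx : x ∈ tree f α :=
      (apply_mem_backwardOrbit_iff (mul_right_injective₀ hl0) (semiconj_unicritical hl)).1 hy
    exact mul_mem
      ((commutingField E _).algebraMap_mem ⟨l, IntermediateField.mem_adjoin_simple_self K l⟩)
      (commutingField_le_restrictScalars E (isMulCommutative_dynGal_iff.1 hcomm hx))
  have hT := preimage_backwardOrbit_subset
    (unicritical d (l * algebraMap K _ c)) (l * algebraMap K _ α)
  have hα : l * algebraMap K _ α ∈ T := self_mem_backwardOrbit _ _
  have hper' := zero_mem_periodicPts_unicritical hl hper
  constructor
  · simpa [hl0] using eq_zero_of_subset_commutingField hd ⟨_, hα⟩ hT hper' hTE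
  · exact eq_zero_or_isOfFinOrder_of_subset_commutingField hd hT hper' hTE hα

theorem mem_maxAbelian_of_isOfFinOrder_mul [PerfectField K]
    (h : IsOfFinOrder (l * algebraMap K _ α)) : l ∈ maxAbelian K := by
  rw [maxAbelian_eq_commutingField,
    ← mul_div_cancel_right₀ l (right_ne_zero_of_mul h.isUnit.ne_zero)]
  exact div_mem (mem_commutingField_of_isOfFinOrder h) ((commutingField K _).algebraMap_mem α)

theorem isConjugateOver_X_pow {L : IntermediateField K (AlgebraicClosure K)} (hl0 : l ≠ 0)
    (hlL : l ∈ L) (hl : l * algebraMap K _ a = l ^ d) :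
    IsConjugateOver L ((C a * X ^ d : K[X]).map (algebraMap K (AlgebraicClosure K)))
      (algebraMap K _ α) (X ^ d) (l * algebraMap K _ α) := by
  refine ⟨l⁻¹, inv_mem hlL, 0, zero_mem L, inv_ne_zero hl0, ?_, ?_⟩
  · have ha0 : algebraMap K (AlgebraicClosure K) a ≠ 0 :=
      right_ne_zero_of_mul (hl ▸ pow_ne_zero d hl0)
    have hinv : algebraMap K _ a * l⁻¹ ^ d = l⁻¹ := by
      rw [inv_pow, ← hl, mul_inv_rev, mul_inv_cancel_left₀ ha0]
    simp only [map_zero, add_zero, Polynomial.map_mul, map_C, Polynomial.map_pow, map_X, mul_comp,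
      C_comp, X_comp, pow_comp, mul_pow]
    rw [← mul_assoc, ← C_pow, ← C_mul, hinv]
  · simp [hl0]

theorem IsConjugateOver.exists_tree_eq_image
    {L : IntermediateField K (AlgebraicClosure K)} {f : K[X]} {g : (AlgebraicClosure K)[X]}
    {β : AlgebraicClosure K}
    (h : IsConjugateOver L (f.map (algebraMap K _)) (algebraMap K _ α) g β) :
    ∃ u ∈ L, ∃ v ∈ L, tree f α = (fun y => u * y + v) '' backwardOrbit (fun y => g.eval y) β := by
  obtain ⟨u, hu, v, hv, hu0, hcomp, hβ⟩ := h
  refine ⟨u, hu, v, hv, ?_⟩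
  have hsemi : Function.Semiconj (fun y => u * y + v) (fun y => g.eval y)
      (fun x => aeval x f) := fun y => by
    simpa [eval_map_algebraMap] using (congrArg (Polynomial.eval y) hcomp).symm
  have hinj : Function.Injective fun y => u * y + v :=
    (add_left_injective v).comp (mul_right_injective₀ hu0)
  have hsurj (x : AlgebraicClosure K) : ∃ y, u * y + v = x :=
    ⟨u⁻¹ * (x - v), by rw [mul_inv_cancel_left₀ hu0, sub_add_cancel]⟩
  replace hβ : u * β + v = algebraMap K _ α := by simpa using hβ
  ext x
  obtain ⟨y, rfl⟩ := hsurj x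
  rw [hinj.mem_set_image, ← apply_mem_backwardOrbit_iff hinj hsemi, tree_eq_backwardOrbit, hβ]

theorem isMulCommutative_dynGal_of_isConjugateOver_zero
    {L : IntermediateField K (AlgebraicClosure K)} {f : K[X]}
    (h : IsConjugateOver L (f.map (algebraMap K _)) (algebraMap K _ α) (X ^ d) 0) :
    IsMulCommutative (dynGal f α) := by
  obtain ⟨u, -, v, -, htree⟩ := h.exists_tree_eq_image
  simp only [eval_pow, eval_X] at htree
  have htree_sub : tree f α ⊆ {v} := by
    rw [htree]
    rintro _ ⟨y, hy, rfl⟩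
    simp [eq_zero_of_mem_backwardOrbit_pow hy]
  have hα := htree_sub (self_mem_backwardOrbit _ _)
  rw [isMulCommutative_dynGal_iff]
  intro x hx
  rw [htree_sub hx, ← hα]
  exact (commutingField K _).algebraMap_mem α

theorem isMulCommutative_dynGal_of_isConjugateOver_isOfFinOrder [PerfectField K] (hd : d ≠ 0)
    {f : K[X]} {ζ : AlgebraicClosure K} (hζ : IsOfFinOrder ζ)
    (h : IsConjugateOver (maxAbelian K) (f.map (algebraMap K _)) (algebraMap K _ α) (X ^ d) ζ) :
    IsMulCommutative (dynGal f α) := by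
  rw [maxAbelian_eq_commutingField] at h
  obtain ⟨u, hu, v, hv, htree⟩ := h.exists_tree_eq_image
  simp only [eval_pow, eval_X] at htree
  rw [isMulCommutative_dynGal_iff, htree]
  rintro _ ⟨y, hy, rfl⟩
  have hy' := isOfFinOrder_of_mem_backwardOrbit_pow hd hζ hy
  exact add_mem (mul_mem hu (mem_commutingField_of_isOfFinOrder hy')) hv

end Conjugation

end Arboreal

open Arboreal

theorem theorem1p2 {K : Type*} [Field K] [NumberField K] (d : ℕ) (hd : 2 ≤ d)
    (a c α : K) (ha : a ≠ 0) (f : K[X]) (hf : f = C a * X ^ d + C c)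
    (hper : (0 : K) ∈ Function.periodicPts (fun x : K => f.eval x)) :
    (IsMulCommutative (Arboreal.dynGal f α) ↔
      c = 0 ∧
        (Arboreal.IsConjugateOver ⊤
            (f.map (algebraMap K (AlgebraicClosure K))) (algebraMap K (AlgebraicClosure K) α)
            (X ^ d) 0 ∨
          ∃ ζ : AlgebraicClosure K, IsOfFinOrder ζ ∧
            Arboreal.IsConjugateOver (Arboreal.maxAbelian K)
              (f.map (algebraMap K (AlgebraicClosure K))) (algebraMap K (AlgebraicClosure K) α)
              (X ^ d) ζ)) ∧
    (a = 1 → IsMulCommutative (Arboreal.dynGal f α) →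
      c = 0 ∧ (α = 0 ∨ IsOfFinOrder α)) := by
  subst hf
  refine ⟨⟨fun hcomm => ?_, ?_⟩, ?_⟩
  · obtain ⟨l, hl0, hl⟩ := exists_mul_eq_pow hd
      ((map_ne_zero (algebraMap K (AlgebraicClosure K))).2 ha)
    obtain ⟨rfl, h | h⟩ := eq_zero_and_isOfFinOrder_of_isMulCommutative hd hl0 hl hper hcomm
    · exact ⟨rfl, Or.inl (by simpa [h] using
        isConjugateOver_X_pow (L := ⊤) (α := α) hl0 trivial hl)⟩
    · refine ⟨rfl, Or.inr ⟨_, h, ?_⟩⟩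
      simpa using isConjugateOver_X_pow hl0 (mem_maxAbelian_of_isOfFinOrder_mul h) hl
  · rintro ⟨-, h | ⟨ζ, hζ, h⟩⟩
    · exact isMulCommutative_dynGal_of_isConjugateOver_zero h
    · exact isMulCommutative_dynGal_of_isConjugateOver_isOfFinOrder (by omega) hζ h
  · rintro rfl hcomm
    obtain ⟨hc, h⟩ := eq_zero_and_isOfFinOrder_of_isMulCommutative (l := 1) hd one_ne_zero
      (by simp) hper hcomm
    rw [one_mul] at h
    exact ⟨hc, h.imp (by simp) (Function.Injective.isOfFinOrder_iff
      (f := (algebraMap K (AlgebraicClosure K)).toMonoidHom) (algebraMap K _).injective).1⟩
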